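/- Let $n \ge 2$, let $G=\mathfrak S_{n+1}$, and let $V$ be the $\mathbf QG$-module with $\mathbf Q$-basis $e_1,\dots,e_n$ on which, for $1\le k\le n$, the adjacent transposition $(k\ k{+}1)$ acts (on coordinate column vectors) as multiplication with the matrix $E^{k,k-1}+2E^{k,k}+E^{k,k+1}-I_n$, where $E^{a,b}$ is the $n\times n$ matrix with a single entry $1$ in position $(a,b)$, and $E^{a,b}=0$ if $a$ or $b$ is not in $\{1,\dots,n\}$ (this is the Specht module of the partition $(2,1^{n-1})$). Put $v=e_n+\sum_{i=1}^{n-1}(-1)^{n+1-i}\,i\,e_i$, and for a divisor $d$ of $n+1$ let $$L(d)=\Bigl(\bigoplus_{i=1}^{n-1}\mathbf Z\,d\,e_i\Bigr)\oplus\mathbf Z v ,$$ which is a $\mathbf ZG$-lattice in $V$. For a prime $p$ let $v_p$ be the $p$-adic valuation, and for a $\mathbf ZG$-lattice $M$ put $M_p=\mathbf Z_p\otimes_{\mathbf Z}M$, a $\mathbf Z_pG$-lattice. The zeta function of a $\mathbf Z_pG$-lattice $M$ is the Dirichlet series $$\zeta_{\mathbf Z_pG}(M,s)=\sum_{L}\,|M:L|^{-s},$$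 where $L$ runs over all $\mathbf Z_pG$-submodules of $M$ of finite index. Corollary. Let $p$ be a prime and let $0\le i\le v_p(n+1)$. Then $$\zeta_{\mathbf Z_pG}(L(p^i)_p,s)=\varphi_{p,i}(p^{-s}),\qquad \varphi_{p,i}=\frac1{1-X^n}\Bigl(\sum_{j=0}^{i}X^j+\sum_{j=i+1}^{v_p(n+1)}X^{(j-i)(n-1)}\Bigr).$$ The identity holds as an identity of formal Dirichlet series, with $\varphi_{p,i}$ read as a power series in $X$ (in particular, $L(p^i)_p$ has only finitely many $\mathbf Z_pG$-submodules of each finite index), and for every $s\in\mathbf C$ with $\operatorname{Re}(s)>0$ it is an identity of complex numbers, the series on the left converging absolutely. -/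

import Mathlib

open scoped TensorProduct

namespace SolomonZeta

/-! ### The representation -/

/-- The coordinates `x₁, …, xₙ` of a vector, extended by `x_m = 0` for `m ∉ {1, …, n}`. -/
def ext (n : ℕ) (x : Fin n → ℚ) (m : ℕ) : ℚ :=
  if h : 1 ≤ m ∧ m ≤ n then x ⟨m - 1, by omega⟩ else 0

/-- The embedding of `ℚⁿ` in `ℚⁿ⁺¹` that sends the standard basis vector `e_k` (`1 ≤ k ≤ n`) to
`(-1)ᵏ (ε_k - ε_{k-1})`, where `ε_0, …, ε_n` is the standard basis of `ℚⁿ⁺¹`; its image consists of the vectors with coordinate sum zero. -/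
def diff (n : ℕ) : (Fin n → ℚ) →ₗ[ℚ] (Fin (n + 1) → ℚ) where
  toFun x j := (-1) ^ (j : ℕ) * (ext n x (j + 1) + ext n x j)
  map_add' x y := by
    funext j; simp only [ext, Pi.add_apply]; split_ifs <;> ring
  map_smul' c x := by
    funext j; simp only [ext, Pi.smul_apply, smul_eq_mul, RingHom.id_apply]; split_ifs <;> ring

/-- Signed partial sums; this inverts `diff n` on the vectors with coordinate sum zero. -/
def psum (n : ℕ) : (Fin (n + 1) → ℚ) →ₗ[ℚ] (Fin n → ℚ) where
  toFun u k := (-1) ^ (k : ℕ) * ∑ j ∈ Finset.univ.filter (fun j : Fin (n + 1) => j ≤ k.castSucc), u j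
  map_add' u w := by
    funext k; simp [Finset.sum_add_distrib, mul_add]
  map_smul' c u := by
    funext k; simp only [Pi.smul_apply, smul_eq_mul, ← Finset.mul_sum, RingHom.id_apply]; ring

theorem sum_filter_le (n : ℕ) (w : ℕ → ℚ) (k : ℕ) (hk : k ≤ n) :
    ∑ j ∈ Finset.univ.filter (fun j : Fin (n + 1) => (j : ℕ) ≤ k), w j
      = ∑ m ∈ Finset.range (k + 1), w m := by
  refine Finset.sum_bij (fun j _ => (j : ℕ)) ?_ ?_ ?_ ?_
  · intro j hj; simp at hj ⊢; omega
  · intro a _ b _ h; exact Fin.ext h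
  · intro m hm; simp at hm; exact ⟨⟨m, by omega⟩, by simp; omega, rfl⟩
  · intros; rfl

theorem sum_range_ext (n : ℕ) (x : Fin n → ℚ) (k : ℕ) :
    ∑ m ∈ Finset.range (k + 1), (-1) ^ m * (ext n x (m + 1) + ext n x m)
      = (-1) ^ k * ext n x (k + 1) := by
  induction k with
  | zero =>
    have h0 : ext n x 0 = 0 := by simp [ext]
    rw [Finset.sum_range_one, h0, add_zero]
  | succ k ih => rw [Finset.sum_range_succ, ih]; ring

theorem psum_diff (n : ℕ) (x : Fin n → ℚ) : psum n (diff n x) = x := by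
  funext k
  have h := sum_filter_le n (fun m => (-1) ^ m * (ext n x (m + 1) + ext n x m)) k (by omega)
  rw [sum_range_ext] at h
  have : psum n (diff n x) k = (-1) ^ (k : ℕ) * ((-1) ^ (k : ℕ) * ext n x (k + 1)) := by
    rw [← h]; rfl
  rw [this, ← mul_assoc, ← mul_pow]
  simp [ext, show (k : ℕ) + 1 ≤ n by omega]

theorem sum_diff (n : ℕ) (x : Fin n → ℚ) : ∑ j, diff n x j = 0 := by
  have h := sum_filter_le n (fun m => (-1) ^ m * (ext n x (m + 1) + ext n x m)) n le_rfl
  rw [sum_range_ext] at h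
  rw [Finset.filter_true_of_mem (by intro j _; omega)] at h
  have h0 : ext n x (n + 1) = 0 := by simp [ext]
  rw [h0, mul_zero] at h
  exact h

theorem diff_psum (n : ℕ) (u : Fin (n + 1) → ℚ) (hu : ∑ j, u j = 0) : diff n (psum n u) = u := by
  set w : ℕ → ℚ := fun m => if h : m < n + 1 then u ⟨m, h⟩ else 0 with hw
  have hwu : ∀ j : Fin (n + 1), w j = u j := fun j => by
    simp only [hw, dif_pos j.2]
  have hps : ∀ m, m ≤ n → ext n (psum n u) (m + 1) =
      (-1) ^ m * ∑ i ∈ Finset.range (m + 1), w i := by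
    intro m hm
    have hs := sum_filter_le n w m hm
    rcases Nat.lt_or_ge m n with h | h
    · rw [← hs]
      simp only [hwu]
      simp only [ext, show 1 ≤ m + 1 ∧ m + 1 ≤ n from ⟨by omega, by omega⟩, and_self, dite_true]
      rfl
    · obtain rfl : m = n := le_antisymm hm h
      rw [← hs]
      simp only [hwu]
      rw [Finset.filter_true_of_mem (by intro j _; omega), hu]
      simp [ext]
  funext j
  have hj := j.2
  change (-1) ^ (j : ℕ) * (ext n (psum n u) (j + 1) + ext n (psum n u) j) = u j
  rw [hps j (by omega), ← hwu j]
  rcases hj' : (j : ℕ) with _ | m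
  · simp [ext]
  · rw [hps m (by omega), Finset.sum_range_succ _ (m + 1)]
    have h1 : ((-1 : ℚ) ^ m) * (-1) ^ m = 1 := by rw [← mul_pow]; simp
    ring_nf
    have h2 : ((-1 : ℚ) ^ (m * 2)) = 1 := by rw [pow_mul, ← pow_mul, mul_comm, pow_mul]; simp
    rw [h2]; ring

/-- The `ℚ 𝔖_{n+1}`-module `V = ℚⁿ`: the sign-twisted permutation action on the vectors of
coordinate sum zero in `ℚⁿ⁺¹`, written in coordinates through `diff n`. By `craigRep_swap` and
`craigRep_unique` it is the unique representation in which the adjacent transposition `(k k+1)` acts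
as the matrix `E^{k,k-1} + 2 E^{k,k} + E^{k,k+1} - I`. -/
noncomputable def craigRep (n : ℕ) : Representation ℚ (Equiv.Perm (Fin (n + 1))) (Fin n → ℚ) where
  toFun g := ((Equiv.Perm.sign g : ℤ) : ℚ) •
    (psum n ∘ₗ LinearMap.funLeft ℚ ℚ (g⁻¹ : Equiv.Perm (Fin (n + 1))) ∘ₗ diff n)
  map_one' := by
    refine LinearMap.ext fun x => ?_
    have h : LinearMap.funLeft ℚ ℚ ((1 : Equiv.Perm (Fin (n + 1)))⁻¹ : Equiv.Perm (Fin (n + 1)))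
        (diff n x) = diff n x := by
      funext j; simp [LinearMap.funLeft_apply]
    simp only [LinearMap.smul_apply, LinearMap.comp_apply, h, psum_diff]
    simp
  map_mul' g h := by
    refine LinearMap.ext fun x => ?_
    have hz : ∑ j, LinearMap.funLeft ℚ ℚ (h⁻¹ : Equiv.Perm (Fin (n + 1))) (diff n x) j = 0 := by
      simp only [LinearMap.funLeft_apply]
      rw [Equiv.sum_comp (h⁻¹ : Equiv.Perm (Fin (n + 1))) (diff n x), sum_diff]
    simp only [Module.End.mul_apply, LinearMap.smul_apply, LinearMap.comp_apply, map_smul,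
      diff_psum _ _ hz, smul_smul, Equiv.Perm.sign_mul]
    congr 1
    push_cast
    ring

/-- `E^{a,b}`, with rows and columns numbered from `1` to `n`; it is `0` if `a` or `b` is not in
`{1, …, n}`. -/
def matE (n : ℕ) (a b : ℤ) : Matrix (Fin n) (Fin n) ℚ :=
  Matrix.of fun i j => if (i : ℤ) + 1 = a ∧ (j : ℤ) + 1 = b then 1 else 0

theorem matE_mulVec (n : ℕ) (a b : ℕ) (x : Fin n → ℚ) (i : Fin n) :
    (matE n a b).mulVec x i = if (i : ℕ) + 1 = a then ext n x b else 0 := by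
  simp only [Matrix.mulVec, dotProduct, matE, Matrix.of_apply]
  by_cases hi : (i : ℕ) + 1 = a
  · have hi' : (i : ℤ) + 1 = a := by exact_mod_cast hi
    simp only [hi', true_and, hi, if_true, ext]
    by_cases hb : 1 ≤ b ∧ b ≤ n
    · rw [dif_pos hb, Finset.sum_eq_single ⟨b - 1, by omega⟩]
      · have : ((b - 1 : ℕ) : ℤ) + 1 = b := by omega
        simp [this]
      · intro j _ hj
        have : ¬ ((j : ℤ) + 1 = b) := fun h => hj (Fin.ext (by simp; omega))
        simp [this]
      · simp
    · rw [dif_neg hb]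
      refine Finset.sum_eq_zero fun j _ => ?_
      have : ¬ ((j : ℤ) + 1 = b) := by have := j.2; omega
      simp [this]
  · have hi' : ¬ (i : ℤ) + 1 = a := by exact_mod_cast hi
    simp [hi', hi]

theorem craigRep_swap_apply (n : ℕ) (k : Fin n) (x : Fin n → ℚ) :
    craigRep n (Equiv.swap k.castSucc k.succ) x =
      -x + Pi.single k (ext n x k + 2 * ext n x (k + 1) + ext n x (k + 2)) := by
  set c := ext n x k + 2 * ext n x (k + 1) + ext n x (k + 2) with hc
  have hext : ∀ m, ext n (x - Pi.single k c) m = ext n x m - if m = k + 1 then c else 0 := by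
    intro m
    by_cases hm : 1 ≤ m ∧ m ≤ n
    · simp only [ext, dif_pos hm, Pi.sub_apply, Pi.single_apply, Fin.ext_iff]
      have : (m - 1 = (k : ℕ)) ↔ m = k + 1 := by omega
      simp [this]
    · have : m ≠ k + 1 := by have := k.2; omega
      simp [ext, dif_neg hm, this]
  have key : LinearMap.funLeft ℚ ℚ ((Equiv.swap k.castSucc k.succ)⁻¹ : Equiv.Perm (Fin (n + 1)))
      (diff n x) = diff n (x - Pi.single k c) := by
    funext j
    rw [LinearMap.funLeft_apply, Equiv.swap_inv]
    change (-1 : ℚ) ^ ((Equiv.swap k.castSucc k.succ j : Fin (n + 1)) : ℕ) *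
      (ext n x ((Equiv.swap k.castSucc k.succ j : Fin (n + 1)) + 1) +
        ext n x (Equiv.swap k.castSucc k.succ j : Fin (n + 1))) =
      (-1) ^ (j : ℕ) * (ext n (x - Pi.single k c) (j + 1) + ext n (x - Pi.single k c) j)
    rw [hext, hext]
    by_cases h1 : j = k.castSucc
    · subst h1
      rw [Equiv.swap_apply_left]
      simp only [Fin.val_succ, Fin.val_castSucc, if_true, hc]
      rw [if_neg (by omega)]
      ring
    · by_cases h2 : j = k.succ
      · subst h2
        rw [Equiv.swap_apply_right]
        simp only [Fin.val_succ, Fin.val_castSucc, if_true, hc]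
        rw [if_neg (by omega)]
        ring
      · rw [Equiv.swap_apply_of_ne_of_ne h1 h2]
        have h1' : ¬ (j : ℕ) = k := fun h => h1 (Fin.ext (by simpa using h))
        have h2' : ¬ (j : ℕ) = k + 1 := fun h => h2 (Fin.ext (by simpa using h))
        rw [if_neg (by omega), if_neg h2']
        ring
  have hne : k.castSucc ≠ k.succ := by
    intro h; have := congrArg Fin.val h; simp at this
  change (((Equiv.Perm.sign (Equiv.swap k.castSucc k.succ) : ℤ) : ℚ) •
    psum n (LinearMap.funLeft ℚ ℚ ((Equiv.swap k.castSucc k.succ)⁻¹ : Equiv.Perm (Fin (n + 1)))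
      (diff n x))) = _
  rw [key, psum_diff, Equiv.Perm.sign_swap hne]
  simp
  abel

/-- In the basis `e₁, …, eₙ` the adjacent transposition `(k k+1)`, `1 ≤ k ≤ n`, acts on column
vectors as multiplication with `E^{k,k-1} + 2 E^{k,k} + E^{k,k+1} - I`. -/
theorem craigRep_swap (n : ℕ) (k : ℕ) (hk : 1 ≤ k ∧ k ≤ n) :
    craigRep n (Equiv.swap (⟨k - 1, by omega⟩ : Fin (n + 1)) ⟨k, by omega⟩) =
      Matrix.toLin' (matE n k (k - 1) + (2 : ℚ) • matE n k k + matE n k (k + 1) - 1) := by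
  obtain ⟨m, rfl⟩ : ∃ m, k = m + 1 := ⟨k - 1, by omega⟩
  refine LinearMap.ext fun x => ?_
  have h := craigRep_swap_apply n ⟨m, by omega⟩ x
  have e1 : (((m + 1 : ℕ) : ℤ) - 1) = ((m : ℕ) : ℤ) := by push_cast; ring
  have e2 : (((m + 1 : ℕ) : ℤ) + 1) = ((m + 2 : ℕ) : ℤ) := by push_cast; ring
  rw [e1, e2, Matrix.toLin'_apply]
  refine h.trans ?_
  funext i
  simp only [Matrix.sub_mulVec, Matrix.add_mulVec, Matrix.smul_mulVec, Matrix.one_mulVec,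
    Pi.add_apply, Pi.sub_apply, Pi.smul_apply, matE_mulVec, Pi.neg_apply, Pi.single_apply,
    Fin.ext_iff, smul_eq_mul, add_left_inj]
  split_ifs <;> ring

/-- A representation of `𝔖_{n+1}` is determined by the adjacent transpositions. -/
theorem craigRep_unique (n : ℕ) (σ : Representation ℚ (Equiv.Perm (Fin (n + 1))) (Fin n → ℚ))
    (h : ∀ k : ℕ, ∀ hk : 1 ≤ k ∧ k ≤ n,
      σ (Equiv.swap (⟨k - 1, by omega⟩ : Fin (n + 1)) ⟨k, by omega⟩) =
        Matrix.toLin' (matE n k (k - 1) + (2 : ℚ) • matE n k k + matE n k (k + 1) - 1)) :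
    σ = craigRep n := by
  refine MonoidHom.eq_of_eqOn_denseM (Equiv.Perm.mclosure_swap_castSucc_succ n) ?_
  rintro _ ⟨i, rfl⟩
  have hi : 1 ≤ (i : ℕ) + 1 ∧ (i : ℕ) + 1 ≤ n := ⟨by omega, by omega⟩
  exact (h (i + 1) hi).trans (craigRep_swap n (i + 1) hi).symm

/-! ### The lattices `L(d)` -/

/-- `v = e_n + ∑_{i=1}^{n-1} (-1)^{n+1-i} i e_i`; the coordinate with index `j : Fin n` belongs to
`e_{j+1}`. -/
def vecV (n : ℕ) : Fin n → ℚ := fun j =>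
  if (j : ℕ) + 1 = n then 1 else (-1) ^ (n + 1 - ((j : ℕ) + 1)) * ((j : ℕ) + 1 : ℚ)

/-- `L(d)`, the `ℤ`-span of `d e_1, …, d e_{n-1}` and `v` in `V`. -/
def lattice (n d : ℕ) : Submodule ℤ (Fin n → ℚ) :=
  Submodule.span ℤ
    ({x | ∃ j : Fin n, (j : ℕ) + 1 < n ∧ x = Pi.single j (d : ℚ)} ∪ {vecV n})

theorem single_mem_lattice (n d : ℕ) (k : Fin n) :
    (Pi.single k (d : ℚ) : Fin n → ℚ) ∈ lattice n d := by
  by_cases hk : (k : ℕ) + 1 < n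
  · exact Submodule.subset_span (Or.inl ⟨k, hk, rfl⟩)
  have hkn : (k : ℕ) + 1 = n := by have := k.2; omega
  have hv : vecV n ∈ lattice n d := Submodule.subset_span (Or.inr rfl)
  have hsum : (Pi.single k (d : ℚ) : Fin n → ℚ) = (d : ℤ) • vecV n -
      ∑ j ∈ Finset.univ.filter (fun j : Fin n => (j : ℕ) + 1 < n),
        ((-1 : ℤ) ^ (n + 1 - ((j : ℕ) + 1)) * ((j : ℕ) + 1 : ℤ)) •
          (Pi.single j (d : ℚ) : Fin n → ℚ) := by
    funext i
    simp only [Pi.sub_apply, Pi.smul_apply, Finset.sum_apply, Pi.single_apply, vecV]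
    by_cases hi : (i : ℕ) + 1 < n
    · rw [Finset.sum_eq_single i]
      · have h1 : i ≠ k := fun h => by subst h; omega
        have h2 : ¬ (i : ℕ) + 1 = n := by omega
        simp [h1, h2]; ring
      · intro j _ hj; simp [hj.symm]
      · intro h; simp at h; omega
    · have hik : i = k := Fin.ext (by have := i.2; omega)
      subst hik
      rw [Finset.sum_eq_zero]
      · simp [hkn]
      · intro j hj
        have : i ≠ j := fun h => by subst h; simp at hj; omega
        simp [this]
  rw [hsum]
  refine Submodule.sub_mem _ (Submodule.smul_mem _ _ hv) (Submodule.sum_mem _ fun j hj => ?_)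
  refine Submodule.smul_mem _ _ (Submodule.subset_span (Or.inl ⟨j, ?_, rfl⟩))
  simpa using hj

theorem single_mul_mem_lattice (n d : ℕ) (k : Fin n) (c : ℤ) (hc : (d : ℤ) ∣ c) :
    (Pi.single k (c : ℚ) : Fin n → ℚ) ∈ lattice n d := by
  obtain ⟨e, rfl⟩ := hc
  have : (Pi.single k (((d : ℤ) * e : ℤ) : ℚ) : Fin n → ℚ) = e • (Pi.single k (d : ℚ)) := by
    funext i
    by_cases h : i = k
    · subst h; simp; ring
    · simp [h]
  rw [this]
  exact Submodule.smul_mem _ _ (single_mem_lattice n d k)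

theorem swap_mem_lattice (n d : ℕ) (hd : d ∣ n + 1) (k : Fin n) (x : Fin n → ℚ)
    (hx : x ∈ lattice n d) :
    craigRep n (Equiv.swap k.castSucc k.succ) x ∈ lattice n d := by
  induction hx using Submodule.span_induction with
  | zero => simp
  | add x y _ _ hx hy => rw [map_add]; exact Submodule.add_mem _ hx hy
  | smul a x _ hx => rw [map_zsmul]; exact Submodule.smul_mem _ _ hx
  | mem x hx =>
    rw [craigRep_swap_apply]
    refine Submodule.add_mem _ (Submodule.neg_mem _ (Submodule.subset_span hx)) ?_
    suffices h : ∃ c : ℤ, (d : ℤ) ∣ c ∧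
        ext n x k + 2 * ext n x (k + 1) + ext n x (k + 2) = (c : ℚ) by
      obtain ⟨c, hc, he⟩ := h
      rw [he]
      exact single_mul_mem_lattice n d k c hc
    rcases hx with ⟨j, hj, rfl⟩ | hx
    · have hs : ∀ m, ∃ c : ℤ, ext n (Pi.single j (d : ℚ)) m = ((d * c : ℤ) : ℚ) := by
        intro m
        by_cases hm : 1 ≤ m ∧ m ≤ n
        · simp only [ext, dif_pos hm, Pi.single_apply]
          split_ifs
          · exact ⟨1, by simp⟩
          · exact ⟨0, by simp⟩
        · exact ⟨0, by simp [ext, dif_neg hm]⟩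
      obtain ⟨a, ha⟩ := hs k
      obtain ⟨b, hb⟩ := hs (k + 1)
      obtain ⟨c, hc⟩ := hs (k + 2)
      refine ⟨d * (a + 2 * b + c), Dvd.intro _ rfl, ?_⟩
      rw [ha, hb, hc]; push_cast; ring
    · rw [Set.mem_singleton_iff] at hx
      subst hx
      have hd' : (d : ℤ) ∣ ((n : ℤ) + 1) := by exact_mod_cast hd
      have hs : ∀ m, m ≤ n + 1 → ∃ c : ℤ, (d : ℤ) ∣ c ∧
          ext n (vecV n) m = (-1) ^ (n + 1 + m) * (m : ℚ) + (c : ℚ) := by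
        intro m hm
        rcases Nat.eq_zero_or_pos m with rfl | h0
        · exact ⟨0, by simp, by simp [ext]⟩
        rcases Nat.lt_or_ge m n with h | h
        · refine ⟨0, by simp, ?_⟩
          have h1 : 1 ≤ m ∧ m ≤ n := ⟨h0, by omega⟩
          have h2 : m - 1 + 1 = m := by omega
          have h3 : ((m - 1 : ℕ) : ℚ) + 1 = m := by exact_mod_cast h2
          have h4 : n + 1 + m = (n + 1 - m) + 2 * m := by omega
          simp only [ext, dif_pos h1, vecV, h2, h3, if_neg (by omega : ¬ m = n)]
          rw [h4, pow_add, pow_mul]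
          simp
        rcases Nat.eq_or_lt_of_le h with rfl | h
        · refine ⟨(n : ℤ) + 1, hd', ?_⟩
          have h1 : 1 ≤ n ∧ n ≤ n := ⟨h0, le_rfl⟩
          have h2 : n - 1 + 1 = n := by omega
          have h4 : n + 1 + n = 2 * n + 1 := by omega
          simp only [ext, dif_pos h1, vecV, h2, if_true]
          rw [h4, pow_succ, pow_mul]
          push_cast
          simp
        · obtain rfl : m = n + 1 := by omega
          refine ⟨-((n : ℤ) + 1), (dvd_neg).2 hd', ?_⟩
          have h4 : n + 1 + (n + 1) = 2 * (n + 1) := by omega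
          have h5 : ext n (vecV n) (n + 1) = 0 := by simp [ext]
          rw [h4, pow_mul, h5]
          push_cast
          simp
      obtain ⟨a, ha', ha⟩ := hs k (by omega)
      obtain ⟨b, hb', hb⟩ := hs (k + 1) (by omega)
      obtain ⟨c, hc', hc⟩ := hs (k + 2) (by omega)
      refine ⟨a + 2 * b + c, by
        exact dvd_add (dvd_add ha' (Dvd.dvd.mul_left hb' 2)) hc', ?_⟩
      rw [ha, hb, hc]; push_cast; ring

/-- If `d ∣ n + 1`, then `L(d)` is stable under the symmetric group. -/
theorem craigRep_mem_lattice (n d : ℕ) (hd : d ∣ n + 1) (g : Equiv.Perm (Fin (n + 1)))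
    (x : Fin n → ℚ) (hx : x ∈ lattice n d) : craigRep n g x ∈ lattice n d := by
  have hg : g ∈ Submonoid.closure
      (Set.range fun i : Fin n => Equiv.swap i.castSucc i.succ) := by
    rw [Equiv.Perm.mclosure_swap_castSucc_succ]; trivial
  induction hg using Submonoid.closure_induction generalizing x with
  | mem g hg => obtain ⟨i, rfl⟩ := hg; exact swap_mem_lattice n d hd i x hx
  | one => simpa using hx
  | mul a b _ _ ha hb => rw [map_mul]; exact ha _ (hb x hx)

/-- The `ℤ 𝔖_{n+1}`-lattice `L(d)`, for `d ∣ n + 1`: the restriction of `craigRep n`. -/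
noncomputable def latticeRep (n d : ℕ) (hd : d ∣ n + 1) :
    Representation ℤ (Equiv.Perm (Fin (n + 1))) (lattice n d) where
  toFun g := ((craigRep n g).restrictScalars ℤ).restrict (craigRep_mem_lattice n d hd g)
  map_one' := by
    refine LinearMap.ext fun x => Subtype.ext ?_
    simp [LinearMap.restrict_apply]
  map_mul' g h := by
    refine LinearMap.ext fun x => Subtype.ext ?_
    change craigRep n (g * h) x.1 = craigRep n g (craigRep n h x.1)
    rw [map_mul]; rfl

/-- `M_p = ℤ_p ⊗ M` with the `ℤ_p G`-module structure obtained by extension of scalars. -/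
noncomputable def localRep {G M : Type*} [Monoid G] [AddCommGroup M] (p : ℕ) [Fact p.Prime]
    (ρ : Representation ℤ G M) : Representation ℤ_[p] G (ℤ_[p] ⊗[ℤ] M) :=
  ((Module.End.baseChangeHom ℤ ℤ_[p] M : Module.End ℤ M →ₐ[ℤ] _) : Module.End ℤ M →* _).comp ρ

/-- The `ℤ_p 𝔖_{n+1}`-lattice `L(p^i)_p`, for `0 ≤ i ≤ v_p(n+1)`. -/
noncomputable def localLatticeRep (n p : ℕ) [Fact p.Prime] (i : ℕ)
    (hi : i ≤ padicValNat p (n + 1)) :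
    Representation ℤ_[p] (Equiv.Perm (Fin (n + 1))) (ℤ_[p] ⊗[ℤ] lattice n (p ^ i)) :=
  localRep p (latticeRep n (p ^ i) ((pow_dvd_pow p hi).trans pow_padicValNat_dvd))

/-! ### Solomon's zeta function -/

/-- The index `|M : L|` of a subrepresentation (`0` if it is infinite). -/
noncomputable def index {R G M : Type*} [CommRing R] [Monoid G] [AddCommGroup M] [Module R M]
    {ρ : Representation R G M} (L : Subrepresentation ρ) : ℕ :=
  L.toSubmodule.toAddSubgroup.index

/-- The `RG`-submodules of finite index. -/
abbrev FinIndexSub {R G M : Type*} [CommRing R] [Monoid G] [AddCommGroup M] [Module R M]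
    (ρ : Representation R G M) : Type _ :=
  {L : Subrepresentation ρ // index L ≠ 0}

/-- The zeta function `∑_L |M : L|^{-s}` as a formal Dirichlet series: its `m`-th coefficient is
the number of `RG`-submodules of index `m`. -/
noncomputable def zeta {R G M : Type*} [CommRing R] [Monoid G] [AddCommGroup M] [Module R M]
    (ρ : Representation R G M) : ArithmeticFunction ℚ where
  toFun m := (Nat.card {L : FinIndexSub ρ // index L.1 = m} : ℚ)
  map_zero' := by
    have : IsEmpty {L : FinIndexSub ρ // index L.1 = 0} := ⟨fun L => L.1.2 L.2⟩
    simp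

/-- `φ_{p,i} = (1 - X^n)⁻¹ (∑_{j=0}^{i} X^j + ∑_{j=i+1}^{v_p(n+1)} X^{(j-i)(n-1)})`, to be used
for the variable `X` of a power series ring and for a complex number `X`. -/
noncomputable def phi {A : Type*} [CommRing A] [Inv A] (n p i : ℕ) (X : A) : A :=
  (1 - X ^ n)⁻¹ * (∑ j ∈ Finset.Icc 0 i, X ^ j +
    ∑ j ∈ Finset.Icc (i + 1) (padicValNat p (n + 1)), X ^ ((j - i) * (n - 1)))

end SolomonZeta

/-! The map `diff` identifies `V` with the sign twist of the sum-zero hyperplane in `ℚⁿ⁺¹`. Under it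
`d e_k` becomes `±d (ε_k - ε_{k-1})` and `v` becomes `±(1 - (n+1) ε_{n-1})`, with `1` the all-ones
vector. Hence `L(pⁱ)_p` becomes the lattice of sum-zero vectors over `ℤ_p` whose coordinates agree
modulo `pⁱ`, which is `stableLattice p n 0 i` (`range_localDiff`). The sign is a unit and does not
affect which submodules are stable.

Let `S` be a nonzero stable submodule of the hyperplane, `k` the least valuation of a coordinate and
`m` the least valuation of a difference of two coordinates. Subtracting from a vector its image
under a transposition shows that `S` contains all `pᵐ (ε_x - ε_y)`. Modulo these, `S` is generated
by one vector with a coordinate of valuation `k`. So `S` is determined by `k` and `j = m - k`, and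
`(n+1) u_a = ∑_b (u_a - u_b)` forces `j ≤ v_p(n+1)` (`exists_eq_stableLattice`).

The lattice `(k, j)` lies in `(0, i)` exactly when `k ≥ i - j`, and its index follows from counting
residues (`relIndex_stableLattice`). Writing `k = k' + max(i - j, 0)`, the index is `p` to the power
`n k' + minExponent n i j`. Summation over `k'` gives the factor `1/(1 - Xⁿ)`, and summation over
`j` gives the finite sum. -/

namespace SolomonZeta

/-! ### Stable lattices in the vectors of coordinate sum zero -/

section Stable

variable (p : ℕ) [Fact p.Prime] (n : ℕ)

/-- The vectors of coordinate sum zero in `ℤ_pⁿ⁺¹` whose coordinates are divisible by `pᵏ` and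
congruent to each other modulo `pᵏ⁺ʲ`. -/
def stableLattice (k j : ℕ) : Submodule ℤ_[p] (Fin (n + 1) → ℤ_[p]) where
  carrier := {u | ∑ a, u a = 0 ∧ (∀ a, (p : ℤ_[p]) ^ k ∣ u a) ∧
    ∀ a b, (p : ℤ_[p]) ^ (k + j) ∣ u a - u b}
  zero_mem' := by simp
  add_mem' := by
    rintro u w ⟨hu, hu', hu''⟩ ⟨hw, hw', hw''⟩
    refine ⟨by simp [Finset.sum_add_distrib, hu, hw], fun a => dvd_add (hu' a) (hw' a),
      fun a b => ?_⟩
    have := dvd_add (hu'' a b) (hw'' a b)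
    rwa [sub_add_sub_comm] at this
  smul_mem' := by
    rintro c u ⟨hu, hu', hu''⟩
    refine ⟨by simp [← Finset.mul_sum, hu], fun a => (hu' a).mul_left c, fun a b => ?_⟩
    simpa [mul_sub] using (hu'' a b).mul_left c

variable {p n}

theorem comp_perm_mem_stableLattice {k j : ℕ} {u : Fin (n + 1) → ℤ_[p]}
    (hu : u ∈ stableLattice p n k j) (g : Equiv.Perm (Fin (n + 1))) :
    u ∘ g ∈ stableLattice p n k j :=
  ⟨(Equiv.sum_comp g u).trans hu.1, fun _ => hu.2.1 _, fun _ _ => hu.2.2 _ _⟩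

/-- A `p`-adic integer of known valuation divides all those of at least this valuation. -/
theorem dvd_of_pow_dvd {x y : ℤ_[p]} {k : ℕ} (hx : ¬ (p : ℤ_[p]) ^ (k + 1) ∣ x)
    (hy : (p : ℤ_[p]) ^ k ∣ y) : x ∣ y := by
  have hx0 : x ≠ 0 := by rintro rfl; exact hx (dvd_zero _)
  refine dvd_trans ?_ hy
  have hle : x.valuation ≤ k := by
    by_contra! h
    refine hx ((pow_dvd_pow _ h).trans ?_)
    exact Dvd.intro_left _ (PadicInt.unitCoeff_spec hx0).symm
  refine dvd_trans ?_ (pow_dvd_pow _ hle)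
  conv_lhs => rw [PadicInt.unitCoeff_spec hx0]
  exact (Units.mul_left_dvd).2 dvd_rfl

/-- Reduces membership of a sum-zero vector in a submodule to membership of multiples of the roots
`ε_b - ε_a`, for one fixed `a`. -/
theorem sum_single_sub_single {R : Type*} [CommRing R] (z : Fin (n + 1) → R) (a : Fin (n + 1))
    (hz : ∑ b, z b = 0) : z = ∑ b, z b • (Pi.single b 1 - Pi.single a 1 : Fin (n + 1) → R) := by
  simp only [smul_sub, Finset.sum_sub_distrib, ← Finset.sum_smul, hz, zero_smul, sub_zero]
  exact pi_eq_sum_univ' z |>.trans (by simp)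

theorem smul_single_sub_single_mem_stableLattice (k j : ℕ) (a b : Fin (n + 1)) :
    ((p : ℤ_[p]) ^ (k + j)) • (Pi.single a 1 - Pi.single b 1 : Fin (n + 1) → ℤ_[p]) ∈
      stableLattice p n k j := by
  refine ⟨by simp [← Finset.mul_sum], fun c => ?_, fun c d => ?_⟩
  · exact (pow_dvd_pow _ (Nat.le_add_right k j)).mul_right _
  · simp only [Pi.smul_apply, smul_eq_mul, ← mul_sub]
    exact dvd_mul_right _ _

theorem pow_dvd_natCast {j : ℕ} (hj : j ≤ padicValNat p (n + 1)) :
    (p : ℤ_[p]) ^ j ∣ ((n + 1 : ℕ) : ℤ_[p]) := by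
  exact_mod_cast Nat.cast_dvd_cast (α := ℤ_[p]) ((pow_dvd_pow p hj).trans pow_padicValNat_dvd)

/-- The constant vector has sum `n + 1`. Correcting this in a single coordinate keeps all
coordinates congruent modulo `pʲ` precisely because `pʲ ∣ n + 1`. -/
theorem smul_one_sub_single_mem_stableLattice (k : ℕ) {j : ℕ} (hj : j ≤ padicValNat p (n + 1))
    (a : Fin (n + 1)) :
    ((p : ℤ_[p]) ^ k) • (1 - Pi.single a ((n + 1 : ℕ) : ℤ_[p]) : Fin (n + 1) → ℤ_[p]) ∈
      stableLattice p n k j := by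
  refine ⟨by simp [← Finset.mul_sum], fun c => dvd_mul_right _ _, fun c d => ?_⟩
  simp only [Pi.smul_apply, smul_eq_mul, ← mul_sub, Pi.sub_apply, pow_add]
  refine mul_dvd_mul_left _ ?_
  have h : ∀ c, (p : ℤ_[p]) ^ j ∣ (Pi.single a ((n + 1 : ℕ) : ℤ_[p]) : Fin (n + 1) → ℤ_[p]) c := by
    intro c
    rw [Pi.single_apply]
    split_ifs
    · exact pow_dvd_natCast hj
    · exact dvd_zero _
  simpa using dvd_sub (h d) (h c)

theorem pow_dvd_pow_iff_le {a b : ℕ} : (p : ℤ_[p]) ^ a ∣ (p : ℤ_[p]) ^ b ↔ a ≤ b :=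
  pow_dvd_pow_iff (PadicInt.prime_p).ne_zero (PadicInt.prime_p).not_isUnit

/-- Two test vectors detect the parameters: the corrected constant vector has a coordinate `pᵏ`, and
a scaled root has a coordinate difference `pᵏ⁺ʲ`. -/
theorem stableLattice_le_iff (hn : 2 ≤ n) {k j k' j' : ℕ} (hj : j ≤ padicValNat p (n + 1)) :
    stableLattice p n k j ≤ stableLattice p n k' j' ↔ k' ≤ k ∧ k' + j' ≤ k + j := by
  constructor
  · intro h
    constructor
    · have := (h (smul_one_sub_single_mem_stableLattice k hj (Fin.last n))).2.1 0
      have h0 : (0 : Fin (n + 1)) ≠ Fin.last n := by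
        simp only [ne_eq, Fin.ext_iff, Fin.val_zero, Fin.val_last]; omega
      simpa [Pi.single_apply, h0, pow_dvd_pow_iff_le] using this
    -- The root is `ε_0 - ε_1`, but coordinate 0 is compared with coordinate 2: the difference with
    -- coordinate 1 would be `2 pᵏ⁺ʲ`, which is too weak for `p = 2`. This needs `n ≥ 2`.
    · have := (h (smul_single_sub_single_mem_stableLattice k j (⟨0, by omega⟩ : Fin (n + 1))
        ⟨1, by omega⟩)).2.2 ⟨0, by omega⟩ ⟨2, by omega⟩
      simpa [Pi.single_apply, Fin.ext_iff, pow_dvd_pow_iff_le] using this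
  · rintro ⟨h, h'⟩ u hu
    exact ⟨hu.1, fun a => (pow_dvd_pow _ h).trans (hu.2.1 a),
      fun a b => (pow_dvd_pow _ h').trans (hu.2.2 a b)⟩

theorem stableLattice_injective (hn : 2 ≤ n) {k j k' j' : ℕ} (hj : j ≤ padicValNat p (n + 1))
    (hj' : j' ≤ padicValNat p (n + 1)) (h : stableLattice p n k j = stableLattice p n k' j') :
    k = k' ∧ j = j' := by
  have h1 := (stableLattice_le_iff hn hj).1 h.le
  have h2 := (stableLattice_le_iff hn hj').1 h.ge
  omega

/-- The vectors of coordinate sum zero contain, up to scaling, only the stable lattices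
`stableLattice p n k j` with `j ≤ v_p(n + 1)`. -/
theorem exists_eq_stableLattice (S : Submodule ℤ_[p] (Fin (n + 1) → ℤ_[p])) (hS : S ≠ ⊥)
    (hsum : ∀ u ∈ S, ∑ a, u a = 0) (hstab : ∀ g : Equiv.Perm (Fin (n + 1)), ∀ u ∈ S, u ∘ g ∈ S) :
    ∃ k j, j ≤ padicValNat p (n + 1) ∧ S = stableLattice p n k j := by
  classical
  have hex : ∃ k, ∃ u ∈ S, ∃ a, ¬ (p : ℤ_[p]) ^ (k + 1) ∣ u a := by
    obtain ⟨u, hu, hu0⟩ := (Submodule.ne_bot_iff S).1 hS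
    obtain ⟨a, ha⟩ := Function.ne_iff.1 hu0
    refine ⟨(u a).valuation, u, hu, a, ?_⟩
    rw [← Ideal.mem_span_singleton, PadicInt.mem_span_pow_iff_le_valuation _ ha]
    omega
  set k := Nat.find hex with hk
  obtain ⟨u, hu, a, hua⟩ := Nat.find_spec hex
  rw [← hk] at hua
  have hkdvd : ∀ w ∈ S, ∀ b, (p : ℤ_[p]) ^ k ∣ w b := by
    intro w hw b
    rcases Nat.eq_zero_or_pos k with h0 | h0
    · simp [h0]
    · by_contra h
      refine Nat.find_min hex (m := k - 1) (by omega) ⟨w, hw, b, ?_⟩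
      rwa [Nat.sub_add_cancel h0]
  set e := padicValNat p (n + 1)
  -- Since `u` has sum zero, `∑_b (u_a - u_b) = (n+1) u_a`, and `u_a` divides `pᵏ`; comparing
  -- valuations bounds `m`.
  have hbound : ∀ m, (∀ w ∈ S, ∀ b c, (p : ℤ_[p]) ^ m ∣ w b - w c) → m ≤ k + e := by
    intro m hm
    have h1 : (p : ℤ_[p]) ^ m ∣ ((n + 1 : ℕ) : ℤ_[p]) * u a := by
      have h2 : ∑ b, (u a - u b) = ((n + 1 : ℕ) : ℤ_[p]) * u a := by
        simp [Finset.sum_sub_distrib, hsum u hu]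
      rw [← h2]
      exact Finset.dvd_sum fun b _ => hm u hu a b
    have h3 : (p : ℤ_[p]) ^ m ∣ ((n + 1 : ℕ) : ℤ_[p]) * (p : ℤ_[p]) ^ k :=
      h1.trans (mul_dvd_mul_left _ (dvd_of_pow_dvd hua dvd_rfl))
    have h4 : p ^ m ∣ (n + 1) * p ^ k := by
      have := (PadicInt.pow_p_dvd_int_iff m (((n + 1) * p ^ k : ℕ) : ℤ)).1
        (by push_cast at h3 ⊢; exact h3)
      exact_mod_cast this
    rw [padicValNat_dvd_iff_le (by have := (Fact.out : p.Prime).pos; positivity),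
      padicValNat.mul (by omega) (by have := (Fact.out : p.Prime).pos; positivity),
      padicValNat.prime_pow] at h4
    omega
  have hex' : ∃ m, ¬ ∀ w ∈ S, ∀ b c, (p : ℤ_[p]) ^ (m + 1) ∣ w b - w c :=
    ⟨k + e, fun h => by have := hbound _ h; omega⟩
  -- The least valuation of a coordinate difference; it exists by `hbound`.
  set m := Nat.find hex' with hm
  have hmspec := Nat.find_spec hex'
  rw [← hm] at hmspec
  have hmdvd : ∀ w ∈ S, ∀ b c, (p : ℤ_[p]) ^ m ∣ w b - w c := by
    rcases Nat.eq_zero_or_pos m with h0 | h0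
    · simp [h0]
    · have := Nat.find_min hex' (m := m - 1) (by omega)
      rw [not_not, Nat.sub_add_cancel h0] at this
      exact this
  have hkm : k ≤ m := by
    by_contra! h
    refine hmspec fun w hw b c => (pow_dvd_pow _ h).trans ?_
    exact dvd_sub (hkdvd w hw b) (hkdvd w hw c)
  have hme := hbound m hmdvd
  refine ⟨k, m - k, by omega, le_antisymm ?_ ?_⟩
  · intro w hw
    refine ⟨hsum w hw, hkdvd w hw, ?_⟩
    rw [Nat.add_sub_cancel' hkm]
    exact hmdvd w hw
  push Not at hmspec
  obtain ⟨w, hw, b, c, hbc⟩ := hmspec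
  have hbc' : b ≠ c := by rintro rfl; simp at hbc
  have hroot : ∀ x y,
      ((p : ℤ_[p]) ^ m) • (Pi.single x 1 - Pi.single y 1 : Fin (n + 1) → ℤ_[p]) ∈ S := by
    have h1 : ((p : ℤ_[p]) ^ m) • (Pi.single b 1 - Pi.single c 1 : Fin (n + 1) → ℤ_[p]) ∈ S := by
      obtain ⟨t, ht⟩ := dvd_of_pow_dvd hbc (dvd_refl ((p : ℤ_[p]) ^ m))
      -- The transposition isolates one root with coefficient of valuation exactly `m`; conjugating
      -- by permutations then yields all the others.
      have h2 : w - w ∘ Equiv.swap b c =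
          (w b - w c) • (Pi.single b 1 - Pi.single c 1 : Fin (n + 1) → ℤ_[p]) := by
        funext d
        by_cases hdb : d = b
        · subst hdb; simp [hbc']
        by_cases hdc : d = c
        · subst hdc; simp [hbc'.symm]
        simp [Equiv.swap_apply_of_ne_of_ne hdb hdc, hdb, hdc]
      rw [ht, mul_comm, mul_smul, ← h2]
      exact S.smul_mem _ (S.sub_mem hw (hstab _ w hw))
    intro x y
    by_cases hxy : x = y
    · simp [hxy]
    obtain ⟨g, hgx, hgy⟩ : ∃ g : Equiv.Perm (Fin (n + 1)), g x = b ∧ g y = c := by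
      have h3 : Equiv.swap x b y ≠ b := by
        intro h
        exact hxy ((Equiv.swap x b).injective (h.trans (Equiv.swap_apply_left x b).symm)).symm
      refine ⟨Equiv.swap (Equiv.swap x b y) c * Equiv.swap x b, ?_, by simp⟩
      rw [Equiv.Perm.mul_apply, Equiv.swap_apply_left, Equiv.swap_apply_of_ne_of_ne h3.symm hbc']
    convert hstab g _ h1 using 1
    subst hgx hgy
    funext d
    simp [Pi.single_apply, g.injective.eq_iff]
  rintro z ⟨hz, hzk, hzm⟩
  rw [Nat.add_sub_cancel' hkm] at hzm
  -- As `u_a` has minimal valuation, some `t • u` agrees with `z` at `a`. The coordinates of `z - t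
  -- • u` are then its differences from coordinate `a`, all divisible by `pᵐ`, so it is a
  -- combination of the roots in `hroot`.
  obtain ⟨t, ht⟩ := dvd_of_pow_dvd hua (hzk a)
  have hy : ∀ d, (p : ℤ_[p]) ^ m ∣ (z - t • u) d := by
    intro d
    have h1 : (z - t • u) d = (z d - z a) - t * (u d - u a) := by
      simp only [Pi.sub_apply, Pi.smul_apply, smul_eq_mul]
      rw [ht]; ring
    rw [h1]
    exact dvd_sub (hzm d a) ((hmdvd u hu d a).mul_left t)
  choose y hy using hy
  have h2 : z - t • u ∈ S := by
    rw [sum_single_sub_single (z - t • u) a (by simp [← Finset.mul_sum, hz, hsum u hu])]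
    refine S.sum_mem fun d _ => ?_
    rw [hy, mul_comm, mul_smul]
    exact S.smul_mem _ (hroot d a)
  simpa using S.add_mem h2 (S.smul_mem t hu)

end Stable

/-! ### The index of a stable lattice -/

section Index

variable {p : ℕ} [Fact p.Prime]

theorem toZModPow_eq_zero_iff {k : ℕ} {x : ℤ_[p]} :
    PadicInt.toZModPow k x = 0 ↔ (p : ℤ_[p]) ^ k ∣ x := by
  rw [← RingHom.mem_ker, PadicInt.ker_toZModPow, Ideal.mem_span_singleton]

/-- The lattice is the kernel, on sum-zero vectors, of reading coordinate 0 modulo `pᵏ` and all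
differences with it except the last modulo `pᵏ⁺ʲ`. The last difference is left out because the sum
condition determines it. The rank is written `n + 1` so that the coordinates split into first,
middle and last. -/
theorem relIndex_stableLattice_succ {n k j : ℕ} (hj : j ≤ padicValNat p (n + 2)) :
    (stableLattice p (n + 1) k j).toAddSubgroup.relIndex
      (stableLattice p (n + 1) 0 0).toAddSubgroup = p ^ (k + (k + j) * n) := by
  let f : (Fin (n + 2) → ℤ_[p]) →+ ZMod (p ^ k) × (Fin n → ZMod (p ^ (k + j))) :=
    { toFun := fun u => (PadicInt.toZModPow k (u 0),
        fun b => PadicInt.toZModPow (k + j) (u b.castSucc.succ - u 0))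
      map_zero' := by simp; rfl
      map_add' := fun u w => by
        refine Prod.ext (by simp) (funext fun b => ?_)
        simp only [Pi.add_apply, Prod.snd_add, ← map_add]
        congr 1; ring }
  have hker : (stableLattice p (n + 1) k j).toAddSubgroup =
      f.ker ⊓ (stableLattice p (n + 1) 0 0).toAddSubgroup := by
    ext u
    simp only [AddSubgroup.mem_inf, AddMonoidHom.mem_ker, Submodule.mem_toAddSubgroup]
    have hf : f u = 0 ↔ (p : ℤ_[p]) ^ k ∣ u 0 ∧
        ∀ b : Fin n, (p : ℤ_[p]) ^ (k + j) ∣ u b.castSucc.succ - u 0 := by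
      simp only [← toZModPow_eq_zero_iff, Prod.ext_iff, funext_iff]
      rfl
    rw [hf]
    constructor
    · intro hu
      exact ⟨⟨hu.2.1 0, fun b => hu.2.2 _ _⟩, hu.1, by simp, by simp⟩
    · rintro ⟨⟨h0, hb⟩, hsum, -, -⟩
      have hall : ∀ a, (p : ℤ_[p]) ^ (k + j) ∣ u a - u 0 := by
        refine Fin.cases (by simp) (Fin.lastCases ?_ hb)
        -- In the sum condition, the term `(n+2) u_0` is divisible by `pᵏ⁺ʲ` because `pʲ ∣ n + 2`
        -- and `pᵏ ∣ u_0`.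
        have hlast : u (Fin.last n).succ - u 0 =
            -(((n + 2 : ℕ) : ℤ_[p]) * u 0) - ∑ b : Fin n, (u b.castSucc.succ - u 0) := by
          rw [Fin.sum_univ_succ, Fin.sum_univ_castSucc] at hsum
          simp only [Finset.sum_sub_distrib, Finset.sum_const, Finset.card_univ, Fintype.card_fin,
            nsmul_eq_mul]
          push_cast
          linear_combination hsum
        rw [hlast]
        refine dvd_sub ((dvd_neg).2 ?_) (Finset.dvd_sum fun b _ => hb b)
        rw [add_comm k j, pow_add]
        exact mul_dvd_mul (pow_dvd_natCast hj) h0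
      have hdiff : ∀ a b, (p : ℤ_[p]) ^ (k + j) ∣ u a - u b := fun a b => by
        simpa using dvd_sub (hall a) (hall b)
      refine ⟨hsum, fun a => ?_, hdiff⟩
      have := dvd_add ((pow_dvd_pow _ (Nat.le_add_right k j)).trans (hall a)) h0
      simpa using this
  have hmap : (stableLattice p (n + 1) 0 0).toAddSubgroup.map f = ⊤ := by
    rw [eq_top_iff]
    rintro ⟨t, s⟩ -
    obtain ⟨t, rfl⟩ := ZMod.ringHom_surjective (PadicInt.toZModPow (p := p) k) t
    choose s' hs' using fun b => ZMod.ringHom_surjective (PadicInt.toZModPow (p := p) (k + j)) (s b)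
    obtain rfl : (fun b => PadicInt.toZModPow (p := p) (k + j) (s' b)) = s := funext hs'
    -- All coordinates but the last are prescribed by the residues; the last one makes the sum zero.
    let w : Fin (n + 2) → ℤ_[p] :=
      Fin.cons t (Fin.snoc (fun b => t + s' b) (-(t + ∑ b, (t + s' b))) : Fin (n + 1) → ℤ_[p])
    refine ⟨w, ⟨?_, by simp, by simp⟩, ?_⟩
    · rw [Fin.sum_univ_succ, Fin.sum_univ_castSucc]
      simp [w]
    · refine Prod.ext (by simp [f, w]) (funext fun b => ?_)
      simp [f, w]
  rw [hker, AddSubgroup.inf_relIndex_right, AddSubgroup.relIndex_ker, hmap, AddSubgroup.card_top,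
    Nat.card_prod, Nat.card_fun, Nat.card_zmod, Nat.card_zmod, Nat.card_fin]
  ring

/-- Multiplicativity of the index in the tower `(k, j) ≤ (0, i) ≤ (0, 0)`, where `i ≤ k + j` ensures
the first inclusion. The product form avoids subtraction of exponents. -/
theorem relIndex_stableLattice {n k j i : ℕ} (hn : 1 ≤ n) (hj : j ≤ padicValNat p (n + 1))
    (hi : i ≤ padicValNat p (n + 1)) (hij : i ≤ k + j) :
    (stableLattice p n k j).toAddSubgroup.relIndex (stableLattice p n 0 i).toAddSubgroup *
      p ^ (i * (n - 1)) = p ^ (k + (k + j) * (n - 1)) := by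
  obtain ⟨n, rfl⟩ : ∃ m, n = m + 1 := ⟨n - 1, by omega⟩
  have h := relIndex_stableLattice_succ (k := 0) hi
  rw [zero_add, zero_add] at h
  rw [Nat.add_sub_cancel, ← relIndex_stableLattice_succ hj, ← h]
  refine AddSubgroup.relIndex_mul_relIndex _ _ _ ?_ ?_
  · rintro u ⟨h1, h2, h3⟩
    refine ⟨h1, by simp, fun a b => (pow_dvd_pow _ ?_).trans (h3 a b)⟩
    omega
  · rintro u ⟨h1, h2, h3⟩
    exact ⟨h1, by simp, by simp⟩

end Index

/-! ### Coordinates on `L(d)` -/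

section Coordinates

variable {n d : ℕ}

theorem ext_single (j : Fin n) (c : ℚ) (m : ℕ) :
    ext n (Pi.single j c) m = if m = j + 1 then c else 0 := by
  by_cases hm : 1 ≤ m ∧ m ≤ n
  · have : (m - 1 = (j : ℕ)) ↔ m = j + 1 := by omega
    simp [ext, hm, Pi.single_apply, Fin.ext_iff, this]
  · have : m ≠ j + 1 := by have := j.2; omega
    simp [ext, hm, this]

/-- Checked through the inverse `psum`: the partial sums of the constant vector give the
coefficients `±(k+1)` of `v`, and the correction by `n + 1` enters only the last one, turning `n`
into `-1`. -/
theorem diff_vecV (hn : 1 ≤ n) (a : Fin (n + 1)) :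
    diff n (vecV n) a = (-1) ^ n * (1 - if (a : ℕ) + 1 = n then (n + 1 : ℚ) else 0) := by
  set u : Fin (n + 1) → ℚ := fun a =>
    (-1) ^ n * (1 - if (a : ℕ) + 1 = n then (n + 1 : ℚ) else 0) with hu
  have hiff : ∀ a : Fin (n + 1), (a : ℕ) + 1 = n ↔ a = (⟨n - 1, by omega⟩ : Fin (n + 1)) := by
    intro a; rw [Fin.ext_iff]; simp only; omega
  have hsum : ∑ a, u a = 0 := by
    simp [hu, ← Finset.mul_sum, Finset.sum_sub_distrib, hiff]
  have hpsum : psum n u = vecV n := by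
    funext k
    change (-1 : ℚ) ^ (k : ℕ) *
      ∑ j ∈ Finset.univ.filter (fun j : Fin (n + 1) => j ≤ k.castSucc), u j = _
    have hcard : (Finset.univ.filter (fun j : Fin (n + 1) => j ≤ k.castSucc)).card = k + 1 := by
      have h : Finset.univ.filter (fun j : Fin (n + 1) => j ≤ k.castSucc) =
          Finset.Iic k.castSucc := by
        ext j; simp
      rw [h, Fin.card_Iic, Fin.val_castSucc]
    have hle : (⟨n - 1, by omega⟩ : Fin (n + 1)) ≤ k.castSucc ↔ (k : ℕ) + 1 = n := by
      rw [Fin.le_def]; simp only [Fin.val_castSucc]; omega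
    simp only [hu, ← Finset.mul_sum, Finset.sum_sub_distrib, Finset.sum_const, hcard, hiff,
      Finset.sum_ite_eq', Finset.mem_filter, Finset.mem_univ, true_and, hle, vecV]
    have hk := k.2
    split_ifs with h
    · have h1 : (n : ℚ) = k + 1 := by exact_mod_cast h.symm
      have h2 : ((-1 : ℚ) ^ (k : ℕ)) * (-1) ^ (k : ℕ) = 1 := by rw [← mul_pow]; simp
      simp only [← h]
      push_cast
      rw [pow_succ]
      linear_combination (1 : ℚ) * h2
    · have h1 : (-1 : ℚ) ^ n = (-1) ^ (k : ℕ) * (-1) ^ (n - k) := by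
        rw [← pow_add]; congr 1; omega
      have h2 : ((-1 : ℚ) ^ (k : ℕ)) * (-1) ^ (k : ℕ) = 1 := by rw [← mul_pow]; simp
      rw [h1]
      simp only [nsmul_eq_mul, mul_one, sub_zero]
      push_cast
      linear_combination ((-1 : ℚ) ^ (n - k : ℕ) * (k + 1)) * h2
  rw [← hpsum, diff_psum n u hsum]

theorem exists_intCast_eq_diff (hn : 1 ≤ n) (hd : d ∣ n + 1) {x : Fin n → ℚ}
    (hx : x ∈ lattice n d) : ∃ u : Fin (n + 1) → ℤ, (∀ a, (u a : ℚ) = diff n x a) ∧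
      ∀ a b, (d : ℤ) ∣ u a - u b := by
  induction hx using Submodule.span_induction with
  | zero => exact ⟨0, by simp, by simp⟩
  | add x y _ _ hx hy =>
    obtain ⟨u, hu, hu'⟩ := hx
    obtain ⟨w, hw, hw'⟩ := hy
    refine ⟨u + w, by simp [hu, hw], fun a b => ?_⟩
    simpa [sub_add_sub_comm] using dvd_add (hu' a b) (hw' a b)
  | smul c x _ hx =>
    obtain ⟨u, hu, hu'⟩ := hx
    refine ⟨c • u, fun a => by rw [map_zsmul]; simp [hu], fun a b => ?_⟩
    simpa [mul_sub] using (hu' a b).mul_left c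
  | mem x hx =>
    rcases hx with ⟨j, -, rfl⟩ | hx
    · refine ⟨fun a => d * ((-1) ^ (a : ℕ) *
        ((if (a : ℕ) + 1 = j + 1 then 1 else 0) + if (a : ℕ) = j + 1 then 1 else 0)), ?_, ?_⟩
      · intro a
        change _ = (-1 : ℚ) ^ (a : ℕ) * (ext n _ (a + 1) + ext n _ a)
        rw [ext_single, ext_single]
        push_cast
        split_ifs <;> ring
      · exact fun a b => dvd_sub (dvd_mul_right _ _) (dvd_mul_right _ _)
    · rw [Set.mem_singleton_iff] at hx
      subst hx
      have hd' : (d : ℤ) ∣ (n : ℤ) + 1 := by exact_mod_cast hd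
      refine ⟨fun a => (-1) ^ n * (1 - if (a : ℕ) + 1 = n then (n + 1 : ℤ) else 0), ?_, ?_⟩
      · intro a; rw [diff_vecV hn]; push_cast; rfl
      · intro a b
        have h : ∀ a : Fin (n + 1), (d : ℤ) ∣ if (a : ℕ) + 1 = n then (n + 1 : ℤ) else 0 := by
          intro a; split_ifs; exacts [hd', dvd_zero _]
        rw [← mul_sub]
        refine Dvd.dvd.mul_left ?_ _
        simpa using dvd_sub (h b) (h a)

/-- The signed partial sums of `d w`, for an integral vector `w`, belong to `L(d)`. -/
theorem psum_smul_mem_lattice (w : Fin (n + 1) → ℤ) :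
    psum n (fun a => ((d * w a : ℤ) : ℚ)) ∈ lattice n d := by
  have h : psum n (fun a => ((d * w a : ℤ) : ℚ)) =
      ∑ k : Fin n, ((-1) ^ (k : ℕ) *
        ∑ j ∈ Finset.univ.filter (fun j : Fin (n + 1) => j ≤ k.castSucc), w j) •
        (Pi.single k (d : ℚ) : Fin n → ℚ) := by
    funext k
    rw [Finset.sum_apply, Finset.sum_eq_single k]
    · change (-1 : ℚ) ^ (k : ℕ) * _ = _
      simp only [Int.cast_mul, ← Finset.mul_sum, Pi.smul_apply, Pi.single_eq_same, zsmul_eq_mul]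
      push_cast
      ring
    · intro b _ hb; simp [hb.symm]
    · simp
  rw [h]
  exact Submodule.sum_mem _ fun k _ => Submodule.smul_mem _ _ (single_mem_lattice n d k)

theorem diff_injective : Function.Injective (diff n) :=
  Function.LeftInverse.injective (psum_diff n)

theorem diff_craigRep (g : Equiv.Perm (Fin (n + 1))) (x : Fin n → ℚ) (a : Fin (n + 1)) :
    diff n (craigRep n g x) a = ((Equiv.Perm.sign g : ℤ) : ℚ) * diff n x (g⁻¹ a) := by
  change diff n (((Equiv.Perm.sign g : ℤ) : ℚ) • psum n (diff n x ∘ (g⁻¹ : Equiv.Perm _))) a = _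
  rw [map_smul, diff_psum]
  · rfl
  · exact (Equiv.sum_comp (g⁻¹ : Equiv.Perm (Fin (n + 1))) (diff n x)).trans (sum_diff n x)

/-- The integral coordinates of the vectors of `L(d)` in `ℚⁿ⁺¹`. -/
noncomputable def latticeDiff (hn : 1 ≤ n) (hd : d ∣ n + 1) :
    lattice n d →ₗ[ℤ] (Fin (n + 1) → ℤ) where
  toFun x := (exists_intCast_eq_diff hn hd x.2).choose
  -- The integral vectors come from choice, but are unique because `ℤ → ℚ` is injective; linearity
  -- can therefore be checked over `ℚ`.
  map_add' x y := by
    funext a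
    apply Int.cast_injective (α := ℚ)
    simp [(exists_intCast_eq_diff hn hd (x + y).2).choose_spec.1,
      (exists_intCast_eq_diff hn hd x.2).choose_spec.1,
      (exists_intCast_eq_diff hn hd y.2).choose_spec.1]
  map_smul' c x := by
    funext a
    apply Int.cast_injective (α := ℚ)
    have := (exists_intCast_eq_diff hn hd (c • x).2).choose_spec.1 a
    rw [this, Submodule.coe_smul, map_zsmul]
    simp [(exists_intCast_eq_diff hn hd x.2).choose_spec.1]

variable (hn : 1 ≤ n) (hd : d ∣ n + 1)

theorem intCast_latticeDiff (x : lattice n d) (a : Fin (n + 1)) :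
    (latticeDiff hn hd x a : ℚ) = diff n x a :=
  (exists_intCast_eq_diff hn hd x.2).choose_spec.1 a

theorem dvd_latticeDiff_sub (x : lattice n d) (a b : Fin (n + 1)) :
    (d : ℤ) ∣ latticeDiff hn hd x a - latticeDiff hn hd x b :=
  (exists_intCast_eq_diff hn hd x.2).choose_spec.2 a b

theorem sum_latticeDiff (x : lattice n d) : ∑ a, latticeDiff hn hd x a = 0 := by
  apply Int.cast_injective (α := ℚ)
  push_cast
  simp only [intCast_latticeDiff, sum_diff]

theorem latticeDiff_injective : Function.Injective (latticeDiff hn hd) := by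
  intro x y hxy
  refine Subtype.ext (diff_injective (funext fun a => ?_))
  rw [← intCast_latticeDiff hn hd, hxy, intCast_latticeDiff]

theorem latticeDiff_latticeRep (g : Equiv.Perm (Fin (n + 1))) (x : lattice n d)
    (a : Fin (n + 1)) : latticeDiff hn hd (latticeRep n d hd g x) a =
      Equiv.Perm.sign g * latticeDiff hn hd x (g⁻¹ a) := by
  apply Int.cast_injective (α := ℚ)
  rw [intCast_latticeDiff, Int.cast_mul, intCast_latticeDiff]
  exact diff_craigRep g x a

theorem exists_latticeDiff_eq_mul (w : Fin (n + 1) → ℤ) (hw : ∑ a, w a = 0) :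
    ∃ x, ∀ a, latticeDiff hn hd x a = d * w a := by
  refine ⟨⟨_, psum_smul_mem_lattice w⟩, fun a => ?_⟩
  apply Int.cast_injective (α := ℚ)
  rw [intCast_latticeDiff, diff_psum]
  rw [← Int.cast_sum, ← Finset.mul_sum, hw, mul_zero, Int.cast_zero]

theorem exists_latticeDiff_eq_one_sub :
    ∃ x, ∀ a : Fin (n + 1), latticeDiff hn hd x a =
      1 - if (a : ℕ) + 1 = n then (n + 1 : ℤ) else 0 := by
  refine ⟨(-1 : ℤ) ^ n • ⟨vecV n, Submodule.subset_span (Or.inr rfl)⟩, fun a => ?_⟩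
  apply Int.cast_injective (α := ℚ)
  have h2 : ((-1 : ℚ) ^ n) * (-1) ^ n = 1 := by rw [← mul_pow]; simp
  rw [map_smul, Pi.smul_apply, smul_eq_mul, Int.cast_mul, intCast_latticeDiff, diff_vecV hn]
  push_cast
  rw [← mul_assoc, h2, one_mul]

variable (p : ℕ) [Fact p.Prime]

/-- The coordinates of the vectors of `ℤ_p ⊗ L(d)` in `ℤ_pⁿ⁺¹`. -/
noncomputable def localDiff : ℤ_[p] ⊗[ℤ] lattice n d →ₗ[ℤ_[p]] (Fin (n + 1) → ℤ_[p]) :=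
  (TensorProduct.piScalarRight ℤ ℤ_[p] ℤ_[p] (Fin (n + 1))).toLinearMap ∘ₗ
    (latticeDiff hn hd).baseChange ℤ_[p]

theorem localDiff_tmul (c : ℤ_[p]) (x : lattice n d) (a : Fin (n + 1)) :
    localDiff hn hd p (c ⊗ₜ x) a = c * latticeDiff hn hd x a := by
  simp [localDiff, TensorProduct.piScalarRightHom_tmul, mul_comm]

/-- Injectivity survives the base change because `ℤ_p` is flat over `ℤ`. -/
theorem localDiff_injective : Function.Injective (localDiff hn hd p) := by
  refine (TensorProduct.piScalarRight ℤ ℤ_[p] ℤ_[p] (Fin (n + 1))).injective.comp ?_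
  exact Module.Flat.lTensor_preserves_injective_linearMap (M := ℤ_[p]) _
    (latticeDiff_injective hn hd)

theorem localDiff_localRep (g : Equiv.Perm (Fin (n + 1))) (x : ℤ_[p] ⊗[ℤ] lattice n d) :
    localDiff hn hd p (localRep p (latticeRep n d hd) g x) =
      ((Equiv.Perm.sign g : ℤ) : ℤ_[p]) • (localDiff hn hd p x ∘ (g⁻¹ : Equiv.Perm _)) := by
  induction x with
  | zero => funext a; simp
  | add x y hx hy =>
    rw [map_add, map_add, hx, hy, map_add]
    funext a
    simp [mul_add]
  | tmul c x =>
    have h : localRep p (latticeRep n d hd) g (c ⊗ₜ x) = c ⊗ₜ latticeRep n d hd g x := rfl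
    funext a
    rw [h, localDiff_tmul, latticeDiff_latticeRep]
    simp only [Pi.smul_apply, Function.comp_apply, localDiff_tmul, smul_eq_mul]
    push_cast
    ring

/-- For the harder inclusion, the image of `±v` has all coordinates congruent to 1 modulo `pⁱ`.
Subtracting `u_0` times it from `u` leaves a sum-zero vector divisible by `pⁱ`, hence a combination
of the roots `pⁱ (ε_b - ε_0)`, which come from `L(pⁱ)`. -/
theorem range_localDiff {i : ℕ} (hi : p ^ i ∣ n + 1) :
    LinearMap.range (localDiff hn hi p) = stableLattice p n 0 i := by
  apply le_antisymm
  · rintro _ ⟨x, rfl⟩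
    induction x with
    | zero => simp
    | add x y hx hy => rw [map_add]; exact Submodule.add_mem _ hx hy
    | tmul c x =>
      refine ⟨?_, by simp, fun a b => ?_⟩
      · simp only [localDiff_tmul, ← Finset.mul_sum, ← Int.cast_sum, sum_latticeDiff]
        simp
      · rw [localDiff_tmul, localDiff_tmul, ← mul_sub, zero_add, ← Int.cast_sub]
        refine Dvd.dvd.mul_left ((PadicInt.pow_p_dvd_int_iff _ _).2 ?_) _
        exact_mod_cast dvd_latticeDiff_sub hn hi x a b
  · rintro u ⟨hsum, -, hu⟩
    rw [zero_add] at hu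
    obtain ⟨v, hv⟩ := exists_latticeDiff_eq_one_sub hn hi
    have hv' : localDiff hn hi p (u 0 ⊗ₜ v) ∈ LinearMap.range (localDiff hn hi p) := ⟨_, rfl⟩
    have hvsum := sum_latticeDiff hn hi v
    suffices h : u - localDiff hn hi p (u 0 ⊗ₜ v) ∈ LinearMap.range (localDiff hn hi p) by
      simpa using Submodule.add_mem _ h hv'
    have hpn : (p : ℤ_[p]) ^ i ∣ (n : ℤ_[p]) + 1 := by
      have := Nat.cast_dvd_cast (α := ℤ_[p]) hi
      push_cast at this
      exact this
    have hdvd : ∀ a, (p : ℤ_[p]) ^ i ∣ (u - localDiff hn hi p (u 0 ⊗ₜ v)) a := by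
      intro a
      have h1 : (u - localDiff hn hi p (u 0 ⊗ₜ v)) a =
          (u a - u 0) + u 0 * if (a : ℕ) + 1 = n then (n + 1 : ℤ_[p]) else 0 := by
        rw [Pi.sub_apply, localDiff_tmul, hv]
        push_cast
        ring
      rw [h1]
      refine dvd_add (hu a 0) (Dvd.dvd.mul_left ?_ _)
      split_ifs
      exacts [hpn, dvd_zero _]
    choose y hy using hdvd
    rw [sum_single_sub_single (u - localDiff hn hi p (u 0 ⊗ₜ v)) 0]
    · refine Submodule.sum_mem _ fun b _ => ?_
      obtain ⟨x, hx⟩ := exists_latticeDiff_eq_mul hn hi (Pi.single b 1 - Pi.single 0 1) (by simp)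
      refine ⟨y b ⊗ₜ x, funext fun a => ?_⟩
      rw [localDiff_tmul, hx, hy]
      simp only [Pi.smul_apply, Pi.sub_apply, Pi.single_apply, smul_eq_mul]
      push_cast
      ring
    · simp only [Pi.sub_apply, localDiff_tmul, Finset.sum_sub_distrib, hsum, ← Finset.mul_sum,
        ← Int.cast_sum, hvsum]
      simp

end Coordinates

/-! ### The submodules of finite index -/

section Submodules

/-- The smallest exponent of `p` in the index of the submodules of `L(pⁱ)_p` that are, up to
scaling, equal to `L(pʲ)_p`. -/
def minExponent (n i j : ℕ) : ℕ := if j ≤ i then i - j else (j - i) * (n - 1)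

theorem dvd_succ_of_le_padicValNat {n p i : ℕ} (hi : i ≤ padicValNat p (n + 1)) : p ^ i ∣ n + 1 :=
  (pow_dvd_pow p hi).trans pow_padicValNat_dvd

variable {n p : ℕ} [Fact p.Prime] {i : ℕ}

/-- The preimage of a stable lattice in `L(pⁱ)_p`. -/
noncomputable def stableSub (hn : 1 ≤ n) (hi : i ≤ padicValNat p (n + 1)) (k j : ℕ) :
    Subrepresentation (localLatticeRep n p i hi) where
  toSubmodule := (stableLattice p n k j).comap
    (localDiff hn (dvd_succ_of_le_padicValNat hi) p)
  apply_mem_toSubmodule g v hv := by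
    rw [Submodule.mem_comap] at hv ⊢
    rw [localLatticeRep, localDiff_localRep]
    exact Submodule.smul_mem _ _ (comp_perm_mem_stableLattice hv _)

/-- The truncated difference `i - j` is the least scaling exponent for which type `j` fits inside
`L(pⁱ)_p`. The further scaling by `pᵏ` contributes `n k` to the exponent, as the rank is `n`. -/
theorem index_stableSub (hn : 1 ≤ n) (hi : i ≤ padicValNat p (n + 1)) (k : ℕ) {j : ℕ}
    (hj : j ≤ padicValNat p (n + 1)) :
    index (stableSub hn hi (k + (i - j)) j) = p ^ (n * k + minExponent n i j) := by
  have hp : 0 < p := (Fact.out : p.Prime).pos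
  have h := relIndex_stableLattice (k := k + (i - j)) hn hj hi (by omega)
  have h1 : index (stableSub hn hi (k + (i - j)) j) =
      (stableLattice p n (k + (i - j)) j).toAddSubgroup.relIndex
        (stableLattice p n 0 i).toAddSubgroup := by
    rw [← range_localDiff hn p (dvd_succ_of_le_padicValNat hi)]
    exact AddSubgroup.index_comap (stableLattice p n (k + (i - j)) j).toAddSubgroup
      (localDiff hn (dvd_succ_of_le_padicValNat hi) p).toAddMonoidHom
  rw [h1]
  refine Nat.eq_of_mul_eq_mul_right (pow_pos hp (i * (n - 1))) (h.trans ?_)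
  rw [← pow_add]
  congr 1
  obtain ⟨m, rfl⟩ : ∃ m, n = m + 1 := ⟨n - 1, by omega⟩
  unfold minExponent
  split_ifs with hij
  · obtain ⟨t, rfl⟩ := Nat.exists_eq_add_of_le hij
    simp only [Nat.add_sub_cancel_left, Nat.add_sub_cancel]
    ring
  · obtain ⟨t, rfl⟩ := Nat.exists_eq_add_of_le (Nat.le_of_not_le hij)
    simp only [Nat.add_sub_cancel_left, Nat.add_sub_cancel,
      Nat.sub_eq_zero_of_le (Nat.le_add_right i t)]
    ring

/-- A nonzero index multiplies the whole module into `L`, and over a torsion-free module it kills no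
nonzero vector. -/
theorem toSubmodule_ne_bot {G M : Type*} [Monoid G] [AddCommGroup M] [Module ℤ_[p] M]
    [Nontrivial M] [Module.IsTorsionFree ℤ_[p] M] {ρ : Representation ℤ_[p] G M}
    {L : Subrepresentation ρ} (hL : index L ≠ 0) : L.toSubmodule ≠ ⊥ := by
  intro h
  obtain ⟨x, hx⟩ := exists_ne (0 : M)
  have h1 : index L • x ∈ L.toSubmodule :=
    AddSubgroup.nsmul_index_mem (H := L.toSubmodule.toAddSubgroup) x
  rw [h, Submodule.mem_bot, ← Nat.cast_smul_eq_nsmul ℤ_[p], smul_eq_zero] at h1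
  exact h1.elim (by exact_mod_cast hL) hx

theorem exists_eq_stableSub (hn : 2 ≤ n) (hi : i ≤ padicValNat p (n + 1))
    (L : Subrepresentation (localLatticeRep n p i hi)) (hL : index L ≠ 0) :
    ∃ k j, j ≤ padicValNat p (n + 1) ∧ L = stableSub (by omega) hi (k + (i - j)) j := by
  have hn1 : 1 ≤ n := by omega
  have hd := dvd_succ_of_le_padicValNat hi
  set Φ := localDiff hn1 hd p with hΦ
  have hinj : Function.Injective Φ := localDiff_injective hn1 hd p
  have hrange := range_localDiff hn1 p hd
  have htf : Module.IsTorsionFree ℤ_[p] (ℤ_[p] ⊗[ℤ] lattice n (p ^ i)) :=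
    hinj.moduleIsTorsionFree Φ (fun c x => map_smul Φ c x)
  have hnt : Nontrivial (ℤ_[p] ⊗[ℤ] lattice n (p ^ i)) := by
    obtain ⟨x, hx⟩ : ((p : ℤ_[p]) ^ (0 + i)) •
        (Pi.single ⟨0, by omega⟩ 1 - Pi.single ⟨1, by omega⟩ 1 : Fin (n + 1) → ℤ_[p]) ∈
          LinearMap.range Φ := by
      rw [hrange]; exact smul_single_sub_single_mem_stableLattice 0 i _ _
    refine ⟨x, 0, ?_⟩
    rintro rfl
    have := congrFun hx ⟨0, by omega⟩
    rw [map_zero] at this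
    simp [Fin.ext_iff, eq_comm (a := (0 : ℤ_[p])),
      (Fact.out : p.Prime).ne_zero] at this
  have hle : L.toSubmodule.map Φ ≤ stableLattice p n 0 i := by
    rw [← hrange]; exact LinearMap.map_le_range
  obtain ⟨k, j, hj, hkj⟩ := exists_eq_stableLattice (L.toSubmodule.map Φ)
    (by
      exact fun h => toSubmodule_ne_bot hL
        (Submodule.map_injective_of_injective hinj (h.trans (Submodule.map_bot Φ).symm)))
    (fun u hu => (hle hu).1)
    (by
      rintro g _ ⟨x, hx, rfl⟩
      -- Applying `g⁻¹` to `x` gives the permuted vector up to the sign of `g⁻¹`; the sign squares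
      -- to 1, so multiplying by it removes the twist.
      have h := localDiff_localRep hn1 hd p g⁻¹ x
      have h1 : ((Equiv.Perm.sign g⁻¹ : ℤ) : ℤ_[p]) * ((Equiv.Perm.sign g⁻¹ : ℤ) : ℤ_[p]) = 1 := by
        rw [← Int.cast_mul, ← Units.val_mul, Int.units_mul_self]; simp
      have h2 := congrArg (((Equiv.Perm.sign g⁻¹ : ℤ) : ℤ_[p]) • ·) h
      simp only [smul_smul, h1, one_smul, inv_inv] at h2
      rw [← hΦ] at h2
      rw [← h2]
      exact Submodule.smul_mem _ _ (Submodule.mem_map_of_mem (L.apply_mem_toSubmodule _ hx)))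
  rw [hkj, stableLattice_le_iff hn hj] at hle
  -- The inclusion in `L(pⁱ)_p` gives `i ≤ k + j`, so this subtraction loses nothing.
  refine ⟨k - (i - j), j, hj, Subrepresentation.toSubmodule_injective ?_⟩
  rw [Nat.sub_add_cancel (by omega)]
  change _ = (stableLattice p n k j).comap Φ
  rw [← hkj, Submodule.comap_map_eq_of_injective hinj]

theorem stableSub_injective (hn : 2 ≤ n) (hi : i ≤ padicValNat p (n + 1)) {k j k' j' : ℕ}
    (hj : j ≤ padicValNat p (n + 1)) (hj' : j' ≤ padicValNat p (n + 1))
    (h : stableSub (by omega) hi (k + (i - j)) j = stableSub (by omega) hi (k' + (i - j')) j') :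
    k = k' ∧ j = j' := by
  have hn1 : 1 ≤ n := by omega
  have hd := dvd_succ_of_le_padicValNat hi
  have hmap := congrArg (fun L => L.toSubmodule.map (localDiff hn1 hd p)) h
  simp only [stableSub, Submodule.map_comap_eq, range_localDiff] at hmap
  -- The image of a preimage is the intersection with the range; both stable lattices already lie in
  -- the range.
  rw [inf_eq_right.2 ((stableLattice_le_iff hn hj).2 ⟨by omega, by omega⟩),
    inf_eq_right.2 ((stableLattice_le_iff hn hj').2 ⟨by omega, by omega⟩)] at hmap
  obtain ⟨h1, rfl⟩ := stableLattice_injective hn hj hj' hmap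
  exact ⟨by omega, rfl⟩

/-- The submodules of finite index of `L(pⁱ)_p`, parametrized by a scaling and a type. -/
noncomputable def finIndexSubEquiv (hn : 2 ≤ n) (hi : i ≤ padicValNat p (n + 1)) :
    ℕ × Fin (padicValNat p (n + 1) + 1) ≃ FinIndexSub (localLatticeRep n p i hi) :=
  Equiv.ofBijective
    (fun x => ⟨stableSub (by omega) hi (x.1 + (i - x.2)) x.2, by
      rw [index_stableSub _ hi _ (Nat.lt_succ_iff.1 x.2.2)]
      exact pow_ne_zero _ (Fact.out : p.Prime).ne_zero⟩)
    ⟨fun x y hxy => by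
      obtain ⟨h1, h2⟩ := stableSub_injective hn hi (Nat.lt_succ_iff.1 x.2.2)
        (Nat.lt_succ_iff.1 y.2.2) (Subtype.ext_iff.1 hxy)
      exact Prod.ext h1 (Fin.ext h2),
    fun L => by
      obtain ⟨k, j, hj, h⟩ := exists_eq_stableSub hn hi L.1 L.2
      exact ⟨(k, ⟨j, Nat.lt_succ_iff.2 hj⟩), Subtype.ext h.symm⟩⟩

theorem index_finIndexSubEquiv (hn : 2 ≤ n) (hi : i ≤ padicValNat p (n + 1))
    (x : ℕ × Fin (padicValNat p (n + 1) + 1)) :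
    index (finIndexSubEquiv hn hi x).1 = p ^ (n * x.1 + minExponent n i x.2) :=
  index_stableSub _ hi _ (Nat.lt_succ_iff.1 x.2.2)

end Submodules

/-! ### The zeta function -/

section Zeta

/-- The types `j ≤ i` contribute `X^(i-j)`, which the reflection `j ↦ i - j` turns into the first
sum of `phi`. -/
theorem sum_pow_minExponent {A : Type*} [CommRing A] (n : ℕ) {i e : ℕ} (hi : i ≤ e) (X : A) :
    ∑ j : Fin (e + 1), X ^ minExponent n i j =
      ∑ j ∈ Finset.Icc 0 i, X ^ j + ∑ j ∈ Finset.Icc (i + 1) e, X ^ ((j - i) * (n - 1)) := by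
  rw [Fin.sum_univ_eq_sum_range (fun j => X ^ minExponent n i j),
    ← Finset.sum_range_add_sum_Ico _ (Nat.succ_le_succ hi), ← Finset.sum_range_reflect]
  congr 1
  · rw [← Nat.range_succ_eq_Icc_zero]
    refine Finset.sum_congr rfl fun j hj => ?_
    rw [Finset.mem_range] at hj
    rw [minExponent, if_pos (by omega)]
    congr 1; omega
  · refine Finset.sum_congr (by ext; simp) fun j hj => ?_
    rw [Finset.mem_Icc] at hj
    rw [minExponent, if_neg (by omega)]

theorem inv_one_sub_X_pow {n : ℕ} (hn : n ≠ 0) :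
    (1 - PowerSeries.X ^ n : PowerSeries ℚ)⁻¹ =
      PowerSeries.mk fun m => if n ∣ m then (1 : ℚ) else 0 := by
  symm
  rw [PowerSeries.eq_inv_iff_mul_eq_one (by simp [hn])]
  ext m
  rw [mul_sub, mul_one, map_sub, mul_comm, PowerSeries.coeff_X_pow_mul', PowerSeries.coeff_mk,
    PowerSeries.coeff_mk, PowerSeries.coeff_one]
  by_cases hm : n ≤ m
  · have : m ≠ 0 := by omega
    have h : n ∣ m - n ↔ n ∣ m := Nat.dvd_sub_iff_left hm dvd_rfl
    simp only [hm, this, h, if_true, if_false, sub_self]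
  · by_cases h0 : m = 0
    · simp [h0, hn]
    · have : ¬ n ∣ m := fun h => hm (Nat.le_of_dvd (Nat.pos_of_ne_zero h0) h)
      simp [hm, h0, this]

/-- For each `j` at most one `k` solves `n k + a j = w`, namely when `a j ≤ w` and `n ∣ w - a j`.
The same condition decides whether `X^(a j) / (1 - Xⁿ)` has coefficient 1 or 0 at `w`. -/
theorem card_exponent_eq_coeff {n : ℕ} (hn : n ≠ 0) {ι : Type*} [Fintype ι] (a : ι → ℕ) (w : ℕ) :
    (Nat.card {x : ℕ × ι // n * x.1 + a x.2 = w} : ℚ) =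
      PowerSeries.coeff w
        ((1 - PowerSeries.X ^ n : PowerSeries ℚ)⁻¹ * ∑ j, PowerSeries.X ^ a j) := by
  classical
  let E : {x : ℕ × ι // n * x.1 + a x.2 = w} ≃ {j // a j ≤ w ∧ n ∣ w - a j} :=
    { toFun := fun x => ⟨x.1.2, by have := x.2; omega, x.1.1, by have := x.2; omega⟩
      invFun := fun j => ⟨((w - a j) / n, j), by
        rw [Nat.mul_div_cancel' j.2.2]; exact Nat.sub_add_cancel j.2.1⟩
      left_inv := by
        rintro ⟨⟨k, j⟩, rfl⟩
        simp [Nat.mul_div_cancel_left _ (Nat.pos_of_ne_zero hn)]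
      right_inv := fun j => rfl }
  rw [Nat.card_congr E, Nat.card_eq_fintype_card, Fintype.card_subtype, Finset.mul_sum, map_sum,
    Finset.card_filter, inv_one_sub_X_pow hn, Nat.cast_sum]
  refine Finset.sum_congr rfl fun j _ => ?_
  rw [mul_comm, PowerSeries.coeff_X_pow_mul', PowerSeries.coeff_mk]
  split_ifs <;> simp_all

theorem finite_exponent_eq {n : ℕ} (hn : n ≠ 0) {ι : Type*} [Finite ι] (a : ι → ℕ) (w : ℕ) :
    Finite {x : ℕ × ι // n * x.1 + a x.2 = w} := by
  refine Finite.of_injective (fun x => x.1.2) ?_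
  rintro ⟨⟨k, j⟩, hk⟩ ⟨⟨k', j'⟩, hk'⟩ (rfl : j = j')
  have : n * k = n * k' := by simp only at hk hk'; omega
  simp [Nat.eq_of_mul_eq_mul_left (Nat.pos_of_ne_zero hn) this]

theorem hasSum_mul_sum {ι κ : Type*} [Fintype κ] {f : ι → ℂ} {c : ℂ} (hf : HasSum f c)
    (hf' : Summable fun k => ‖f k‖) (g : κ → ℂ) :
    HasSum (fun y : ι × κ => f y.1 * g y.2) (c * ∑ j, g j) :=
  hf.mul (hasSum_fintype g)
    (summable_mul_of_summable_norm hf' (hasSum_fintype fun j => ‖g j‖).summable)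

theorem hasSum_pow_exponent {n : ℕ} (hn : n ≠ 0) {ι : Type*} [Fintype ι] (a : ι → ℕ) {x : ℂ}
    (hx : ‖x‖ < 1) :
    HasSum (fun y : ℕ × ι => x ^ (n * y.1 + a y.2)) ((1 - x ^ n)⁻¹ * ∑ j, x ^ a j) := by
  have hxn : ‖x ^ n‖ < 1 := by rw [norm_pow]; exact pow_lt_one₀ (norm_nonneg x) hx hn
  have h := hasSum_mul_sum (hasSum_geometric_of_norm_lt_one hxn)
    (summable_norm_geometric_of_norm_lt_one hxn) fun j => x ^ a j
  refine h.congr_fun fun y => ?_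
  rw [pow_add, pow_mul]

end Zeta

end SolomonZeta

theorem mainTheorem4 (n : ℕ) (hn : 2 ≤ n) (p : ℕ) [Fact p.Prime] (i : ℕ)
    (hi : i ≤ padicValNat p (n + 1)) :
    (∀ m : ℕ, Finite {L : SolomonZeta.FinIndexSub (SolomonZeta.localLatticeRep n p i hi) //
      SolomonZeta.index L.1 = m}) ∧
    SolomonZeta.zeta (SolomonZeta.localLatticeRep n p i hi) =
      ArithmeticFunction.ofPowerSeries p (SolomonZeta.phi n p i (PowerSeries.X : PowerSeries ℚ)) ∧
    ∀ s : ℂ, 0 < s.re →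
      HasSum (fun L : SolomonZeta.FinIndexSub (SolomonZeta.localLatticeRep n p i hi) =>
          (SolomonZeta.index L.1 : ℂ) ^ (-s))
        (SolomonZeta.phi n p i ((p : ℂ) ^ (-s))) := by
  have hn0 : n ≠ 0 := by omega
  have hp : 1 < p := (Fact.out : p.Prime).one_lt
  set E := SolomonZeta.finIndexSubEquiv hn hi with hE
  have hindex := SolomonZeta.index_finIndexSubEquiv hn hi
  have hpow : ∀ w, Nonempty ({L : SolomonZeta.FinIndexSub (SolomonZeta.localLatticeRep n p i hi) //
      SolomonZeta.index L.1 = p ^ w} ≃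
      {x : ℕ × Fin (padicValNat p (n + 1) + 1) //
        n * x.1 + SolomonZeta.minExponent n i x.2 = w}) := fun w =>
    ⟨(E.subtypeEquiv fun x => by rw [hindex, (Nat.pow_right_injective hp).eq_iff]).symm⟩
  -- Every finite index is a power of `p`, matching the support of a Dirichlet series obtained from
  -- a power series in `p^(-s)`.
  have hempty : ∀ m, (¬ ∃ w, p ^ w = m) →
      IsEmpty {L : SolomonZeta.FinIndexSub (SolomonZeta.localLatticeRep n p i hi) //
        SolomonZeta.index L.1 = m} := fun m hm =>
    ⟨fun L => hm ⟨_, by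
      have h := hindex (E.symm L.1)
      rw [← hE, E.apply_symm_apply] at h
      exact h.symm.trans L.2⟩⟩
  refine ⟨fun m => ?_, ?_, fun s hs => ?_⟩
  · by_cases hm : ∃ w, p ^ w = m
    · obtain ⟨w, rfl⟩ := hm
      have := SolomonZeta.finite_exponent_eq hn0
        (fun j : Fin (padicValNat p (n + 1) + 1) => SolomonZeta.minExponent n i j) w
      exact Finite.of_equiv _ (hpow w).some.symm
    · have := hempty m hm
      infer_instance
  · ext m
    change (Nat.card _ : ℚ) = _
    by_cases hm : ∃ w, p ^ w = m
    · obtain ⟨w, rfl⟩ := hm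
      rw [ArithmeticFunction.ofPowerSeries_apply_pow hp, SolomonZeta.phi,
        ← SolomonZeta.sum_pow_minExponent n hi, Nat.card_congr (hpow w).some,
        SolomonZeta.card_exponent_eq_coeff hn0
          (fun j : Fin (padicValNat p (n + 1) + 1) => SolomonZeta.minExponent n i j)]
    · have := hempty m hm
      rw [ArithmeticFunction.ofPowerSeries_apply hp, Function.extend_apply' _ _ _ hm,
        Nat.card_of_isEmpty]
      simp
  · have hx : ‖(p : ℂ) ^ (-s)‖ < 1 := by
      rw [Complex.norm_natCast_cpow_of_pos (by omega), Complex.neg_re]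
      exact Real.rpow_lt_one_of_one_lt_of_neg (by exact_mod_cast hp) (by linarith)
    -- `HasSum` is unconditional summation, which in `ℂ` amounts to absolute convergence, so the sum
    -- may be reindexed along `E`.
    rw [SolomonZeta.phi, ← SolomonZeta.sum_pow_minExponent n hi, ← E.hasSum_iff]
    convert SolomonZeta.hasSum_pow_exponent hn0
      (fun j : Fin (padicValNat p (n + 1) + 1) => SolomonZeta.minExponent n i j) hx using 2 with x
    rw [Function.comp_apply, hindex, Nat.cast_pow, ← Complex.natCast_cpow_natCast_mul,
      Complex.cpow_nat_mul]
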